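/- Let $M$ be a smooth manifold (without boundary) of dimension $m$, let $U\subseteq M$ be open, and let $\mathcal F$ be a regular foliation on $U$ with leaves of dimension $r$ and codimension $q=m-r$. Suppose that $\mathcal F$ is defined by $\omega=0$, where $\omega\in\Omega^{q}(U)$; that is, $\omega$ is smooth, has no zeros on $U$, and the vectors $v$ tangent to the leaves are exactly those with $\iota_v\omega=0$. Let $\mu\in\Omega^1(U)$ satisfy $d\omega=\omega\wedge\mu$ on $U$. Let $\varphi\in C^\infty(M)$ be a test function for $M\setminus U$, i.e. $\varphi(x)=0$ if and only if $x\in M\setminus U$, and assume that $\varphi$ is basic for $\mathcal F$, i.e. $d\varphi(v)=0$ for every vector $v$ tangent to a leaf of $\mathcal F$. Let $\bar\mu$ be the one-form on $M$ that equals $\varphi\mu$ on $U$ and $0$ on $M\setminus U$, and assume that $\bar\mu$ is smooth on $M$. Then the smooth form $\bar\nu=\bar\mu\wedge(d\bar\mu)^{q}\in\Omega^{2q+1}(M)$ is closed, $d\bar\nu=0$, and so it defines a de Rham cohomology class $[\bar\nu]\in H^{2q+1}(M)$. -/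

import Mathlib

open Set TopologicalSpace
open scoped Manifold ContDiff

/-! ### The wedge product of alternating forms on a real vector space -/

section Wedge

variable {V : Type*} [AddCommGroup V] [Module ℝ V] [TopologicalSpace V] {k l : ℕ}

/-- The wedge product of two real-valued alternating forms, without normalising factor:
`(a ∧ b)(v) = ∑ sign σ • a (v_σ(1), …, v_σ(k)) * b (v_σ(k+1), …, v_σ(k+l))`, the sum over all
`(k, l)`-shuffles `σ`. This is the convention for which Mathlib's `extDeriv` satisfies the
Leibniz rule. -/
def wedgeAlg (a : V [⋀^Fin k]→ₗ[ℝ] ℝ) (b : V [⋀^Fin l]→ₗ[ℝ] ℝ) : V [⋀^Fin (k + l)]→ₗ[ℝ] ℝ :=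
  ((LinearMap.mul' ℝ ℝ).compAlternatingMap (a.domCoprod b)).domDomCongr finSumFinEquiv

theorem continuous_wedgeAlg (a : V [⋀^Fin k]→L[ℝ] ℝ) (b : V [⋀^Fin l]→L[ℝ] ℝ) :
    Continuous fun v => wedgeAlg a.toAlternatingMap b.toAlternatingMap v := by
  have h : ∀ v, wedgeAlg a.toAlternatingMap b.toAlternatingMap v =
      ∑ σ : Equiv.Perm.ModSumCongr (Fin k) (Fin l),
        LinearMap.mul' ℝ ℝ (AlternatingMap.domCoprod.summand a.toAlternatingMap b.toAlternatingMap
          σ (v ∘ finSumFinEquiv)) := by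
    intro v
    simp [wedgeAlg, AlternatingMap.domCoprod_apply, Function.comp_def]
  simp_rw [h]
  refine continuous_finsetSum _ fun σ _ => ?_
  induction σ using Quotient.inductionOn' with
  | h σ =>
    have h2 : ∀ v : Fin (k + l) → V, LinearMap.mul' ℝ ℝ (AlternatingMap.domCoprod.summand
        a.toAlternatingMap b.toAlternatingMap (Quotient.mk'' σ) (v ∘ finSumFinEquiv)) =
        Equiv.Perm.sign σ • (a (fun i => v (finSumFinEquiv (σ (Sum.inl i)))) *
          b (fun i => v (finSumFinEquiv (σ (Sum.inr i))))) := by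
      intro v
      rcases Int.units_eq_one_or (Equiv.Perm.sign σ) with hs | hs <;>
        simp [AlternatingMap.domCoprod.summand_mk'', hs, Function.comp_def]
    simp_rw [h2]
    have ha : Continuous fun v : Fin (k + l) → V =>
        a (fun i => v (finSumFinEquiv (σ (Sum.inl i)))) :=
      a.coe_continuous.comp (continuous_pi fun i => continuous_apply _)
    have hb : Continuous fun v : Fin (k + l) → V =>
        b (fun i => v (finSumFinEquiv (σ (Sum.inr i)))) :=
      b.coe_continuous.comp (continuous_pi fun i => continuous_apply _)
    rcases Int.units_eq_one_or (Equiv.Perm.sign σ) with hs | hs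
    · simp only [hs, one_smul]; exact ha.mul hb
    · simp only [hs, Units.neg_smul, one_smul]; exact (ha.mul hb).neg

/-- The wedge product of continuous alternating forms. -/
def wedge (a : V [⋀^Fin k]→L[ℝ] ℝ) (b : V [⋀^Fin l]→L[ℝ] ℝ) : V [⋀^Fin (k + l)]→L[ℝ] ℝ :=
  { wedgeAlg a.toAlternatingMap b.toAlternatingMap with
    cont := continuous_wedgeAlg a b }

/-- The `n`-th power of an alternating form for the wedge product; the `0`-th power is the
constant `0`-form `1`. -/
def wedgePow (a : V [⋀^Fin k]→L[ℝ] ℝ) : (n : ℕ) → V [⋀^Fin (k * n)]→L[ℝ] ℝ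
  | 0 => ContinuousAlternatingMap.constOfIsEmpty ℝ V (Fin 0) 1
  | n + 1 => wedge (wedgePow a n) a

end Wedge

/-! ### Differential forms on a manifold of dimension `m` -/

section Forms

variable (m : ℕ) (M : Type*) [TopologicalSpace M] [ChartedSpace (EuclideanSpace ℝ (Fin m)) M]

/-- A (not necessarily smooth) differential `k`-form on `M`: an alternating `k`-linear form on
every tangent space. -/
def DiffForm (k : ℕ) : Type _ :=
  (x : M) → TangentSpace (𝓡 m) x [⋀^Fin k]→L[ℝ] ℝ

noncomputable instance DiffForm.instAddCommGroup (k : ℕ) : AddCommGroup (DiffForm m M k) :=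
  inferInstanceAs (AddCommGroup ((x : M) → TangentSpace (𝓡 m) x [⋀^Fin k]→L[ℝ] ℝ))

noncomputable instance DiffForm.instModule (k : ℕ) : Module ℝ (DiffForm m M k) :=
  inferInstanceAs (Module ℝ ((x : M) → TangentSpace (𝓡 m) x [⋀^Fin k]→L[ℝ] ℝ))

variable {m M} {k : ℕ}

/-- The coordinate expression of a form in the chart at `x`, i.e. its pullback under the inverse
of that chart; it is meaningful on the target of the chart. -/
noncomputable def DiffForm.inChart (α : DiffForm m M k) (x : M) :
    EuclideanSpace ℝ (Fin m) → EuclideanSpace ℝ (Fin m) [⋀^Fin k]→L[ℝ] ℝ := fun y =>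
  (α ((extChartAt (𝓡 m) x).symm y)).compContinuousLinearMap
    (mfderiv 𝓘(ℝ, EuclideanSpace ℝ (Fin m)) (𝓡 m) (extChartAt (𝓡 m) x).symm y)

/-- The form is smooth on the open set `U`: its coordinate expressions are. The values of the
form outside `U` play no role, so that this describes the elements of `Ω^k(U)`. -/
def DiffForm.IsSmoothOn (α : DiffForm m M k) (U : Opens M) : Prop :=
  ∀ x : M, ContDiffOn ℝ ∞ (α.inChart x)
    ((extChartAt (𝓡 m) x).target ∩ (extChartAt (𝓡 m) x).symm ⁻¹' (U : Set M))

/-- The exterior derivative of a form, computed at each point `x` in the chart at `x`. -/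
noncomputable def DiffForm.d (α : DiffForm m M k) : DiffForm m M (k + 1) := fun x =>
  (extDeriv (α.inChart x) (extChartAt (𝓡 m) x x)).compContinuousLinearMap
    (mfderiv (𝓡 m) 𝓘(ℝ, EuclideanSpace ℝ (Fin m)) (extChartAt (𝓡 m) x) x)

/-- For a one-form `η` the form `η ∧ (dη)^q`, of degree `2q + 1`. -/
noncomputable def DiffForm.godbillonVey (η : DiffForm m M 1) (q : ℕ) :
    DiffForm m M (1 + 2 * q) := fun x =>
  wedge (η x) (wedgePow (η.d x) q)

/-! ### De Rham cohomology -/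

theorem DiffForm.inChart_add (α η : DiffForm m M k) (x : M) :
    (α + η).inChart x = α.inChart x + η.inChart x := rfl

theorem DiffForm.inChart_smul (c : ℝ) (α : DiffForm m M k) (x : M) :
    (c • α).inChart x = c • α.inChart x := rfl

theorem DiffForm.inChart_zero (x : M) : (0 : DiffForm m M k).inChart x = 0 := rfl

theorem DiffForm.IsSmoothOn.differentiableAt {α : DiffForm m M k} (h : α.IsSmoothOn ⊤) (x : M) :
    DifferentiableAt ℝ (α.inChart x) (extChartAt (𝓡 m) x x) := by
  refine ((h x).contDiffAt ?_).differentiableAt (by simp)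
  simpa using extChartAt_target_mem_nhds (I := 𝓡 m) x

theorem DiffForm.d_add {α η : DiffForm m M k} (hα : α.IsSmoothOn ⊤) (hη : η.IsSmoothOn ⊤) :
    (α + η).d = α.d + η.d := by
  funext x
  simp only [DiffForm.d, DiffForm.inChart_add]
  rw [extDeriv_add (hα.differentiableAt x) (hη.differentiableAt x)]
  rfl

theorem DiffForm.d_smul (c : ℝ) (α : DiffForm m M k) : (c • α).d = c • α.d := by
  funext x
  simp only [DiffForm.d, DiffForm.inChart_smul]
  rw [extDeriv_smul]
  rfl

theorem DiffForm.d_zero : (0 : DiffForm m M k).d = 0 := by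
  simpa using DiffForm.d_smul 0 (0 : DiffForm m M k)

variable (m M) (k)

/-- `Ω^k(M)`, the space of smooth `k`-forms on `M`. -/
def smoothForms : Submodule ℝ (DiffForm m M k) where
  carrier := {α | α.IsSmoothOn ⊤}
  zero_mem' := fun x => by
    rw [DiffForm.inChart_zero]; exact contDiffOn_const
  add_mem' := fun {α η} hα hη x => by
    rw [DiffForm.inChart_add]; exact (hα x).add (hη x)
  smul_mem' := fun c α hα x => by
    rw [DiffForm.inChart_smul]; exact (hα x).const_smul c

/-- The closed smooth `k`-forms on `M`. -/
def closedForms : Submodule ℝ (DiffForm m M k) where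
  carrier := {α | α ∈ smoothForms m M k ∧ α.d = 0}
  zero_mem' := ⟨zero_mem _, DiffForm.d_zero⟩
  add_mem' := fun {α η} hα hη =>
    ⟨add_mem hα.1 hη.1, by rw [DiffForm.d_add hα.1 hη.1, hα.2, hη.2, add_zero]⟩
  smul_mem' := fun c α hα =>
    ⟨Submodule.smul_mem _ c hα.1, by rw [DiffForm.d_smul, hα.2, smul_zero]⟩

/-- The exact `k`-forms on `M`: the forms `dη` with `η` a smooth `(k-1)`-form (only `0` when
`k = 0`). -/
noncomputable def exactForms : (k : ℕ) → Submodule ℝ (DiffForm m M k)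
  | 0 => ⊥
  | k + 1 =>
    { carrier := {α | ∃ η ∈ smoothForms m M k, η.d = α}
      zero_mem' := ⟨0, zero_mem _, DiffForm.d_zero⟩
      add_mem' := by
        rintro _ _ ⟨η, hη, rfl⟩ ⟨θ, hθ, rfl⟩
        exact ⟨η + θ, add_mem hη hθ, DiffForm.d_add hη hθ⟩
      smul_mem' := by
        rintro c _ ⟨η, hη, rfl⟩
        exact ⟨c • η, Submodule.smul_mem _ c hη, DiffForm.d_smul c η⟩ }

/-- The de Rham cohomology `H^k(M)`: closed forms modulo exact forms. -/
abbrev DeRhamCohomology : Type _ :=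
  closedForms m M k ⧸ (exactForms m M k).submoduleOf (closedForms m M k)

variable {m M k}

/-- The cohomology class `c` is the class `[ν]` of the closed form `ν`. -/
def DeRhamCohomology.IsClassOf (c : DeRhamCohomology m M k) (ν : DiffForm m M k) : Prop :=
  ∃ h : ν ∈ closedForms m M k, Submodule.Quotient.mk ⟨ν, h⟩ = c

end Forms

/-! ### Regular foliations, basic functions, test functions -/

section Foliations

variable (m : ℕ) {M : Type*} [TopologicalSpace M] [ChartedSpace (EuclideanSpace ℝ (Fin m)) M]

/-- A regular foliation on the open set `U ⊆ M` with leaves of dimension `r`, given by the tangent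
spaces to its leaves: around every point of `U` there is a smooth chart of `M`, with domain in `U`,
in which the leaves are the slices `(x_r, …, x_{m-1}) = const` (coordinates being numbered from
`0`), i.e. in which a vector is tangent to the leaves iff its last `m - r` components vanish.
The values of `tangent` outside `U` play no role. -/
structure RegularFoliation (U : Opens M) (r : ℕ) where
  tangent : (x : M) → Submodule ℝ (TangentSpace (𝓡 m) x)
  le_dim : r ≤ m
  exists_foliated_chart : ∀ x ∈ U, ∃ e ∈ IsManifold.maximalAtlas (𝓡 m) ∞ M, x ∈ e.source ∧
    ∀ y ∈ e.source, y ∈ U ∧ ∀ v : TangentSpace (𝓡 m) y, v ∈ tangent y ↔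
      ∀ i : Fin m, r ≤ (i : ℕ) →
        (show EuclideanSpace ℝ (Fin m) from
          mfderiv (𝓡 m) 𝓘(ℝ, EuclideanSpace ℝ (Fin m)) e y v) i = 0

variable {m} {U : Opens M} {r : ℕ}

/-- The foliation is defined on `U` by the equation `α = 0`, where `α ∈ Ω^q(U)`: the form is smooth
and without zeros on `U`, and the vectors tangent to the leaves are exactly those whose interior
product with `α` vanishes. When `q` is the codimension of the foliation, `α` is then locally a
product `α_1 ∧ ⋯ ∧ α_q` of one-forms that span the one-forms vanishing on the leaves. -/
structure RegularFoliation.IsDefinedBy (F : RegularFoliation m U r) {q : ℕ}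
    (α : DiffForm m M q) : Prop where
  isSmoothOn : α.IsSmoothOn U
  ne_zero : ∀ x ∈ U, α x ≠ 0
  mem_tangent_iff : ∀ x ∈ U, ∀ v : TangentSpace (𝓡 m) x, v ∈ F.tangent x ↔
    ∀ (w : Fin q → TangentSpace (𝓡 m) x) (i : Fin q), w i = v → α x w = 0

/-- The function `φ` is basic for the foliation on `U`: its derivative vanishes in all directions
tangent to the leaves. -/
def RegularFoliation.IsBasic (F : RegularFoliation m U r) (φ : M → ℝ) : Prop :=
  ∀ x ∈ U, ∀ v ∈ F.tangent x, mvfderiv (𝓡 m) φ x v = 0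

variable (m) in
/-- A (weak) test function for the set `M₀`: a smooth real function on `M` whose set of zeros
is `M₀`. -/
structure IsTestFunction (φ : M → ℝ) (M₀ : Set M) : Prop where
  contMDiff : ContMDiff (𝓡 m) 𝓘(ℝ, ℝ) ∞ φ
  eq_zero_iff : ∀ x, φ x = 0 ↔ x ∈ M₀

end Foliations

/-! ### Signed sums over permutations -/

section SignedSums

open Equiv

variable {ι κ : Type*} [Fintype ι] [DecidableEq ι] [Fintype κ] [DecidableEq κ]

/-! Write `ω` for the defining form and `η` for `μbar`. On `U`, `0 = ddω = d(ω ∧ μ) = ω ∧ μ ∧ μ ± ω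
∧ dμ = ± ω ∧ dμ`. Evaluated on `q` vectors where `ω` is nonzero, followed by two leaf vectors, this
leaves `ω(w) dμ(u) = 0`, so `dμ` vanishes on pairs of leaf vectors
(`extDeriv_apply_eq_zero_of_extDeriv_eq_wedge`). As `φ` is basic, `dη = dφ ∧ μ + φ dμ` does so too
(`extDeriv_smul_apply_eq_zero`).

Hence each factor `dη` needs at least one argument transverse to the leaves, and `(dη)^(q+1)` needs
`q + 1` of them. A basis adapted to the foliation has at most `q`, so `(dη)^(q+1) = 0` on `U`
(`VanishesBelow.wedge`, `VanishesBelow.eq_zero`). By continuity this holds on the closure of `U`,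
and off the closure `η` is locally zero. Finally `d(η ∧ (dη)^q) = dη ∧ (dη)^q` since `ddη = 0`.

The Leibniz rule and `μ ∧ μ = 0` are obtained by expanding wedge and alternatization as signed sums
over all permutations and comparing the sums. The computations take place in charts;
`DiffForm.d_inChart` makes `d` independent of the chart. -/

theorem sum_sign_mul_right (f : Perm ι → ℝ) (c : Perm ι) :
    ∑ σ : Perm ι, ((Perm.sign σ : ℤ) : ℝ) * f (σ * c) =
      ((Perm.sign c : ℤ) : ℝ) * ∑ σ : Perm ι, ((Perm.sign σ : ℤ) : ℝ) * f σ := by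
  rw [← Equiv.sum_comp (Equiv.mulRight c) fun σ => ((Perm.sign σ : ℤ) : ℝ) * f σ, Finset.mul_sum]
  refine Finset.sum_congr rfl fun σ _ => ?_
  rcases Int.units_eq_one_or (Perm.sign c) with h | h <;> simp [h]

/-- Nested antisymmetrizations collapse: for fixed `τ`, translating `σ` by the extension of `τ`
produces a second factor `sign τ`, so all `τ` contribute equally. -/
theorem sum_sign_mul_sum_viaFintypeEmbedding (f : Perm ι → ℝ) (e : κ ↪ ι) :
    ∑ σ : Perm ι, ((Perm.sign σ : ℤ) : ℝ) *
      ∑ τ : Perm κ, ((Perm.sign τ : ℤ) : ℝ) * f (σ * τ.viaFintypeEmbedding e) =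
      (Fintype.card κ).factorial * ∑ σ : Perm ι, ((Perm.sign σ : ℤ) : ℝ) * f σ := by
  simp_rw [Finset.mul_sum]
  rw [Finset.sum_comm, ← Finset.mul_sum]
  have h (τ : Perm κ) : ∑ σ : Perm ι, ((Perm.sign σ : ℤ) : ℝ) * (((Perm.sign τ : ℤ) : ℝ) *
      f (σ * τ.viaFintypeEmbedding e)) = ∑ σ : Perm ι, ((Perm.sign σ : ℤ) : ℝ) * f σ := by
    simp_rw [mul_left_comm _ (((Perm.sign τ : ℤ) : ℝ))]
    rw [← Finset.mul_sum, sum_sign_mul_right, Perm.viaFintypeEmbedding_sign, ← mul_assoc]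
    rcases Int.units_eq_one_or (Perm.sign τ) with h | h <;> simp [h]
  simp_rw [h]
  simp [Fintype.card_perm]

end SignedSums

/-! ### The algebra of the wedge product -/

section WedgeAlgebra

open Equiv

variable {V : Type*} [AddCommGroup V] [Module ℝ V] [TopologicalSpace V] {k l : ℕ}

theorem wedge_apply (a : V [⋀^Fin k]→L[ℝ] ℝ) (b : V [⋀^Fin l]→L[ℝ] ℝ) (v : Fin (k + l) → V) :
    wedge a b v = ∑ σ : Perm.ModSumCongr (Fin k) (Fin l),
        LinearMap.mul' ℝ ℝ (AlternatingMap.domCoprod.summand a.toAlternatingMap b.toAlternatingMap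
          σ (v ∘ finSumFinEquiv)) := by
  change wedgeAlg _ _ v = _
  simp [wedgeAlg, AlternatingMap.domCoprod_apply, Function.comp_def]

theorem mul'_domCoprod_summand (a : V [⋀^Fin k]→L[ℝ] ℝ) (b : V [⋀^Fin l]→L[ℝ] ℝ)
    (v : Fin (k + l) → V) (σ : Perm (Fin k ⊕ Fin l)) :
    LinearMap.mul' ℝ ℝ (AlternatingMap.domCoprod.summand
        a.toAlternatingMap b.toAlternatingMap (Quotient.mk'' σ) (v ∘ finSumFinEquiv)) =
        ((Perm.sign σ : ℤ) : ℝ) * (a (fun i => v (finSumFinEquiv (σ (Sum.inl i)))) *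
          b (fun i => v (finSumFinEquiv (σ (Sum.inr i))))) := by
  rcases Int.units_eq_one_or (Equiv.Perm.sign σ) with hs | hs <;>
    simp [AlternatingMap.domCoprod.summand_mk'', hs, Function.comp_def]

/-- Every shuffle class has `k! l!` representatives with equal signed terms. Replacing the quotient
by the full permutation group turns later identities into reindexings. -/
theorem factorial_mul_factorial_mul_wedge_apply (a : V [⋀^Fin k]→L[ℝ] ℝ) (b : V [⋀^Fin l]→L[ℝ] ℝ)
    (v : Fin (k + l) → V) :
    (k.factorial * l.factorial : ℝ) * wedge a b v =
      ∑ σ : Perm (Fin (k + l)), ((Perm.sign σ : ℤ) : ℝ) *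
        (a (fun i => v (σ (Fin.castAdd l i))) * b (fun i => v (σ (Fin.natAdd k i)))) := by
  have h := congrArg (fun A => LinearMap.mul' ℝ ℝ (A (v ∘ finSumFinEquiv)))
    (MultilinearMap.domCoprod_alternization_eq a.toAlternatingMap b.toAlternatingMap)
  have h2 : wedge a b v = LinearMap.mul' ℝ ℝ
      (a.toAlternatingMap.domCoprod b.toAlternatingMap (v ∘ finSumFinEquiv)) := by
    change wedgeAlg _ _ v = _
    simp [wedgeAlg, Function.comp_def]
  simp only [Fintype.card_fin] at h
  rw [AlternatingMap.smul_apply, map_nsmul, ← h2, MultilinearMap.alternatization_apply, map_sum,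
    nsmul_eq_mul, Nat.cast_mul] at h
  rw [← h, ← Equiv.sum_comp (finSumFinEquiv (m := k) (n := l)).permCongr]
  refine Finset.sum_congr rfl fun σ _ => ?_
  rw [Perm.sign_permCongr]
  rcases Int.units_eq_one_or (Equiv.Perm.sign σ) with hs | hs <;>
    simp [hs, Function.comp_def, Equiv.permCongr_apply]

/-- Every shuffle class except that of the identity feeds one of the last `l` vectors to `a`, which
kills the term. -/
theorem wedge_apply_of_right_mem_ker (a : V [⋀^Fin k]→L[ℝ] ℝ) (b : V [⋀^Fin l]→L[ℝ] ℝ) {K : Set V}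
    (hK : ∀ (w : Fin k → V) (i : Fin k), w i ∈ K → a w = 0) (v : Fin (k + l) → V)
    (hv : ∀ i, v (Fin.natAdd k i) ∈ K) :
    wedge a b v = a (fun i => v (Fin.castAdd l i)) * b (fun i => v (Fin.natAdd k i)) := by
  rw [wedge_apply]
  refine (Fintype.sum_eq_single (Quotient.mk'' 1) ?_).trans ?_
  · intro σ hσ
    induction σ using Quotient.inductionOn' with
    | h σ =>
      rw [mul'_domCoprod_summand]
      by_cases h : Set.MapsTo σ (Set.range Sum.inl) (Set.range Sum.inl)
      · refine absurd (Eq.symm ?_) hσ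
        refine Quotient.sound' ?_
        rw [QuotientGroup.leftRel_apply]
        simpa using Perm.mem_sumCongrHom_range_of_perm_mapsTo_inl h
      · simp only [Set.MapsTo, Set.mem_range, forall_exists_index, forall_apply_eq_imp_iff,
          not_forall] at h
        obtain ⟨i, hi⟩ := h
        obtain ⟨j, hj⟩ : ∃ j, σ (Sum.inl i) = Sum.inr j := by
          rcases h : σ (Sum.inl i) with j | j
          · exact absurd ⟨j, h.symm⟩ hi
          · exact ⟨j, rfl⟩
        rw [hK _ i (by rw [hj]; simpa using hv j)]
        simp
  · rw [mul'_domCoprod_summand]; simp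

/-- A form vanishes on all tuples with less than `n` entries outside `K`. -/
def VanishesBelow (K : Set V) (a : V [⋀^Fin k]→L[ℝ] ℝ) (n : ℕ) : Prop :=
  ∀ w : Fin k → V, {i | w i ∉ K}.ncard < n → a w = 0

/-- Pigeonhole: each shuffle term distributes the entries outside `K` over the two factors, so one
factor receives too few. This replaces powers of the ideal of forms vanishing on the leaves, without
splitting into one-forms. -/
theorem VanishesBelow.wedge {K : Set V} {a : V [⋀^Fin k]→L[ℝ] ℝ} {b : V [⋀^Fin l]→L[ℝ] ℝ}
    {n p : ℕ} (ha : VanishesBelow K a n) (hb : VanishesBelow K b p) :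
    VanishesBelow K (wedge a b) (n + p) := by
  intro v hv
  rw [wedge_apply]
  refine Finset.sum_eq_zero fun σ _ => ?_
  induction σ using Quotient.inductionOn' with
  | h σ =>
    rw [mul'_domCoprod_summand]
    set f : Fin k → Fin (k + l) := fun i => finSumFinEquiv (σ (Sum.inl i)) with hf
    set g : Fin l → Fin (k + l) := fun i => finSumFinEquiv (σ (Sum.inr i)) with hg
    have hfi : Function.Injective f := fun i j h => by simpa [hf] using h
    have hgi : Function.Injective g := fun i j h => by simpa [hg] using h
    have hd : Disjoint (f '' {i | v (f i) ∉ K}) (g '' {i | v (g i) ∉ K}) := by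
      rw [Set.disjoint_left]
      rintro _ ⟨i, -, rfl⟩ ⟨j, -, h⟩
      simp [hf, hg] at h
    have hle : {i | v (f i) ∉ K}.ncard + {i | v (g i) ∉ K}.ncard ≤ {i | v i ∉ K}.ncard := by
      rw [← Set.ncard_image_of_injective _ hfi, ← Set.ncard_image_of_injective _ hgi,
        ← Set.ncard_union_eq hd]
      refine Set.ncard_le_ncard ?_
      rintro _ (⟨i, hi, rfl⟩ | ⟨i, hi, rfl⟩) <;> exact hi
    rcases lt_or_ge {i | v (f i) ∉ K}.ncard n with h | h
    · rw [ha (fun i => v (f i)) h]; simp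
    · rw [hb (fun i => v (g i)) (by omega)]; simp

theorem VanishesBelow.wedgePow {K : Set V} {a : V [⋀^Fin k]→L[ℝ] ℝ} (ha : VanishesBelow K a 1) :
    ∀ n, VanishesBelow K (wedgePow a n) n
  | 0 => fun _ h => absurd h (Nat.not_lt_zero _)
  | n + 1 => (VanishesBelow.wedgePow ha n).wedge ha

/-- An alternating form is determined by its values on tuples of distinct basis vectors, and such a
tuple has no more entries outside `K` than the basis has. -/
theorem VanishesBelow.eq_zero {K : Set V} {a : V [⋀^Fin k]→L[ℝ] ℝ} {n : ℕ}
    (ha : VanishesBelow K a n) {ι : Type*} [Finite ι] (b : Module.Basis ι ℝ V)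
    (hb : {i | b i ∉ K}.ncard < n) : a = 0 := by
  have h : a.toAlternatingMap = 0 := by
    refine Module.Basis.ext_alternating b fun v hv => ?_
    refine ha _ (lt_of_le_of_lt ?_ hb)
    rw [← Set.ncard_image_of_injective _ hv]
    refine Set.ncard_le_ncard ?_ (Set.toFinite _)
    rintro _ ⟨i, hi, rfl⟩
    exact hi
  ext v
  exact congrArg (fun A => A v) h

theorem wedge_wedge_self_right_eq_zero (a : V [⋀^Fin k]→L[ℝ] ℝ) (b : V [⋀^Fin 1]→L[ℝ] ℝ) :
    wedge (wedge a b) b = 0 := by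
  ext v
  have h1 := factorial_mul_factorial_mul_wedge_apply (wedge a b) b v
  set f : Perm (Fin (k + 1 + 1)) → ℝ := fun σ =>
    a (fun i => v (σ (Fin.castAdd 1 (Fin.castAdd 1 i)))) *
      b (fun i => v (σ (Fin.castAdd 1 (Fin.natAdd k i)))) *
      b (fun i => v (σ (Fin.natAdd (k + 1) i))) with hf
  have h2 := sum_sign_mul_sum_viaFintypeEmbedding f (Fin.castAddEmb (n := k + 1) 1)
  have h3 := sum_sign_mul_right f (swap (Fin.castAdd 1 (Fin.natAdd k 0)) (Fin.natAdd (k + 1) 0))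
  -- Exchanging the two arguments of `b` preserves the summand but reverses the sign, so the signed
  -- sum equals its own negative.
  have h4 : ∀ σ, f (σ * swap (Fin.castAdd 1 (Fin.natAdd k 0)) (Fin.natAdd (k + 1) 0)) = f σ := by
    intro σ
    have hne (i : Fin k) : swap (Fin.castAdd 1 (Fin.natAdd k (0 : Fin 1)))
        (Fin.natAdd (k + 1) (0 : Fin 1)) (Fin.castAdd 1 (Fin.castAdd 1 i)) =
          Fin.castAdd 1 (Fin.castAdd 1 i) := by
      apply swap_apply_of_ne_of_ne <;> simp [Fin.ext_iff] <;> omega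
    simp only [hf, Perm.mul_apply, hne, Subsingleton.elim _ (0 : Fin 1), swap_apply_left,
      swap_apply_right]
    ring
  rw [Perm.sign_swap (by simp [Fin.ext_iff])] at h3
  simp only [h4] at h3
  have h0 : ∑ σ : Perm (Fin (k + 1 + 1)), ((Perm.sign σ : ℤ) : ℝ) * f σ = 0 := by
    simp only [Units.val_neg, Units.val_one, Int.cast_neg, Int.cast_one] at h3
    linarith
  rw [h0, mul_zero] at h2
  -- The extra factor `k! 1!` is what expanding the inner wedge requires.
  have h6 : (k.factorial * Nat.factorial 1 : ℝ) * (((k + 1).factorial * Nat.factorial 1 : ℝ) *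
      wedge (wedge a b) b v) = 0 := by
    rw [h1, Finset.mul_sum, ← h2]
    refine Finset.sum_congr rfl fun σ _ => ?_
    rw [mul_left_comm, ← mul_assoc (_ * _ : ℝ) (wedge a b _),
      factorial_mul_factorial_mul_wedge_apply, Finset.sum_mul]
    congr 1
    refine Finset.sum_congr rfl fun τ _ => ?_
    have hl (i : Fin (k + 1)) : τ.viaFintypeEmbedding (Fin.castAddEmb 1) (Fin.castAdd 1 i) =
        Fin.castAdd 1 (τ i) := Perm.viaFintypeEmbedding_apply_image τ (Fin.castAddEmb 1) i
    have hr (i : Fin 1) : τ.viaFintypeEmbedding (Fin.castAddEmb 1) (Fin.natAdd (k + 1) i) =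
        Fin.natAdd (k + 1) i := by
      refine Perm.viaFintypeEmbedding_apply_notMem_range _ _ ?_
      rintro ⟨j, hj⟩
      simp [Fin.ext_iff] at hj
      omega
    simp only [hf, Perm.mul_apply, hl, hr]
    ring
  simpa [Nat.factorial_ne_zero] using h6

end WedgeAlgebra

/-! ### Alternatization of a derivative and the algebraic Leibniz rule -/

section AlternatizeUncurry

open Equiv ContinuousAlternatingMap

variable {E : Type*} [NormedAddCommGroup E] [NormedSpace ℝ E] {k l n : ℕ}

theorem factorial_mul_alternatizeUncurryFin_apply (D : E →L[ℝ] E [⋀^Fin n]→L[ℝ] ℝ)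
    (v : Fin (n + 1) → E) :
    (n.factorial : ℝ) * alternatizeUncurryFin D v =
      ∑ σ : Perm (Fin (n + 1)), ((Perm.sign σ : ℤ) : ℝ) *
        D (v (σ 0)) (fun i => v (σ i.succ)) := by
  set f : Perm (Fin (n + 1)) → ℝ := fun σ => D (v (σ 0)) (fun i => v (σ i.succ)) with hf
  -- The signed sum over all rearrangements of `v` is computed twice: by antisymmetry here, by
  -- expanding the alternatization in `h2`.
  have h1 : ∑ σ : Perm (Fin (n + 1)), ((Perm.sign σ : ℤ) : ℝ) *
      alternatizeUncurryFin D (fun i => v (σ i)) =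
      ((n + 1).factorial : ℝ) * alternatizeUncurryFin D v := by
    have h (σ : Perm (Fin (n + 1))) : alternatizeUncurryFin D (fun i => v (σ i)) =
        ((Perm.sign σ : ℤ) : ℝ) * alternatizeUncurryFin D v := by
      have := (alternatizeUncurryFin D).toAlternatingMap.map_perm v σ
      rw [Units.smul_def, zsmul_eq_mul] at this
      exact this
    simp_rw [h]
    have h' (σ : Perm (Fin (n + 1))) : ((Perm.sign σ : ℤ) : ℝ) * (((Perm.sign σ : ℤ) : ℝ) *
        alternatizeUncurryFin D v) = alternatizeUncurryFin D v := by
      rcases Int.units_eq_one_or (Equiv.Perm.sign σ) with hs | hs <;> simp [hs]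
    simp_rw [h']
    simp [Fintype.card_perm]
  have h2 : ∑ σ : Perm (Fin (n + 1)), ((Perm.sign σ : ℤ) : ℝ) *
      alternatizeUncurryFin D (fun i => v (σ i)) = (n + 1) * ∑ σ, ((Perm.sign σ : ℤ) : ℝ) * f σ := by
    simp_rw [alternatizeUncurryFin_apply, Finset.mul_sum]
    rw [Finset.sum_comm, ← Finset.mul_sum]
    have h (i : Fin (n + 1)) : ∑ σ : Perm (Fin (n + 1)), ((Perm.sign σ : ℤ) : ℝ) *
        ((-1) ^ (i : ℕ) • D (v (σ i)) (i.removeNth fun i => v (σ i))) =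
        ∑ σ, ((Perm.sign σ : ℤ) : ℝ) * f σ := by
      -- This cycle sends `0` to `i` and keeps the other indices in order; its sign `(-1)^i` cancels
      -- the one in the alternatization.
      have h3 := sum_sign_mul_right f i.cycleRange.symm
      have h4 : ∀ σ : Perm (Fin (n + 1)), f (σ * i.cycleRange.symm) =
          D (v (σ i)) (i.removeNth fun i => v (σ i)) := by
        intro σ
        simp only [hf, Perm.mul_apply, Fin.cycleRange_symm_zero, Fin.cycleRange_symm_succ]
        rfl
      simp_rw [h4, Perm.sign_symm, Fin.sign_cycleRange] at h3
      simp_rw [zsmul_eq_mul, mul_left_comm _ (((-1 : ℤ) ^ (i : ℕ) : ℤ) : ℝ)]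
      rw [← Finset.mul_sum, h3, ← mul_assoc]
      push_cast
      rw [← mul_pow]
      norm_num
    simp_rw [h]
    simp
  rw [h1, Nat.factorial_succ, Nat.cast_mul, mul_assoc, Nat.cast_add_one] at h2
  exact mul_left_cancel₀ (Nat.cast_add_one_ne_zero n) h2

/-- Up to the same factor `k! l!`, both sides are one full antisymmetrization of `D ⊗ b`. The cast
only identifies `k + l + 1` with `k + 1 + l`. -/
theorem alternatizeUncurryFin_wedge_left (D : E →L[ℝ] E [⋀^Fin k]→L[ℝ] ℝ)
    (b : E [⋀^Fin l]→L[ℝ] ℝ) (D' : E →L[ℝ] E [⋀^Fin (k + l)]→L[ℝ] ℝ)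
    (hD' : ∀ v, D' v = wedge (D v) b) (v : Fin (k + l + 1) → E) :
    alternatizeUncurryFin D' v =
      wedge (alternatizeUncurryFin D) b (v ∘ Fin.cast (Nat.add_right_comm k 1 l)) := by
  set f : Perm (Fin (k + l + 1)) → ℝ := fun σ =>
    D (v (σ 0)) (fun i => v (σ (Fin.castAdd l i).succ)) *
      b (fun i => v (σ (Fin.natAdd k i).succ)) with hf
  set w : Fin (k + 1 + l) → E := v ∘ Fin.cast (Nat.add_right_comm k 1 l) with hw
  set g : Perm (Fin (k + 1 + l)) → ℝ := fun σ =>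
    D (w (σ (Fin.castAdd l 0))) (fun i => w (σ (Fin.castAdd l i.succ))) *
      b (fun i => w (σ (Fin.natAdd (k + 1) i))) with hg
  have hgf : ∑ σ : Perm (Fin (k + 1 + l)), ((Perm.sign σ : ℤ) : ℝ) * g σ =
      ∑ σ : Perm (Fin (k + l + 1)), ((Perm.sign σ : ℤ) : ℝ) * f σ := by
    rw [← Equiv.sum_comp (finCongr (Nat.add_right_comm k 1 l)).permCongr]
    refine Finset.sum_congr rfl fun σ _ => ?_
    rw [Perm.sign_permCongr]
    congr 1
    have h0 : Fin.cast (Nat.add_right_comm k 1 l).symm 0 = Fin.castAdd l (0 : Fin (k + 1)) := by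
      ext; simp
    have h1 (i : Fin k) : Fin.cast (Nat.add_right_comm k 1 l).symm (Fin.castAdd l i).succ =
        Fin.castAdd l i.succ := by
      ext; simp
    have h2 (i : Fin l) : Fin.cast (Nat.add_right_comm k 1 l).symm (Fin.natAdd k i).succ =
        Fin.natAdd (k + 1) i := by
      ext; simp; omega
    simp only [hg, hf, hw, Equiv.permCongr_apply, finCongr_symm, finCongr_apply, h0, h1, h2,
      Function.comp_apply]
  have hL : (k.factorial * l.factorial : ℝ) * alternatizeUncurryFin D' v =
      ∑ σ : Perm (Fin (k + l + 1)), ((Perm.sign σ : ℤ) : ℝ) * f σ := by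
    have h := sum_sign_mul_sum_viaFintypeEmbedding f (Fin.succEmb (k + l))
    rw [Fintype.card_fin] at h
    refine mul_left_cancel₀ (Nat.cast_ne_zero.2 (Nat.factorial_ne_zero (k + l))) (Eq.trans ?_ h)
    rw [mul_left_comm, factorial_mul_alternatizeUncurryFin_apply, Finset.mul_sum]
    refine Finset.sum_congr rfl fun σ _ => ?_
    rw [hD', mul_left_comm, factorial_mul_factorial_mul_wedge_apply]
    congr 1
    refine Finset.sum_congr rfl fun τ _ => ?_
    have hs (i : Fin (k + l)) : τ.viaFintypeEmbedding (Fin.succEmb (k + l)) i.succ =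
        (τ i).succ := Perm.viaFintypeEmbedding_apply_image τ (Fin.succEmb (k + l)) i
    have h0 : τ.viaFintypeEmbedding (Fin.succEmb (k + l)) 0 = 0 := by
      refine Perm.viaFintypeEmbedding_apply_notMem_range _ _ ?_
      rintro ⟨j, hj⟩
      exact Fin.succ_ne_zero j hj
    simp only [hf, Perm.mul_apply, hs, h0]
  have hR : (k.factorial * l.factorial : ℝ) * wedge (alternatizeUncurryFin D) b w =
      ∑ σ : Perm (Fin (k + 1 + l)), ((Perm.sign σ : ℤ) : ℝ) * g σ := by
    have h := sum_sign_mul_sum_viaFintypeEmbedding g (Fin.castAddEmb (n := k + 1) l)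
    rw [Fintype.card_fin] at h
    refine mul_left_cancel₀ (Nat.cast_ne_zero.2 (Nat.factorial_ne_zero (k + 1))) (Eq.trans ?_ h)
    have h' := factorial_mul_factorial_mul_wedge_apply (alternatizeUncurryFin D) b w
    calc ((k + 1).factorial : ℝ) * ((k.factorial * l.factorial : ℝ) *
          wedge (alternatizeUncurryFin D) b w) = k.factorial * (((k + 1).factorial * l.factorial) *
          wedge (alternatizeUncurryFin D) b w) := by ring
      _ = _ := by
        rw [h', Finset.mul_sum]
        refine Finset.sum_congr rfl fun σ _ => ?_
        rw [mul_left_comm, ← mul_assoc (_ : ℝ) (alternatizeUncurryFin D _),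
          factorial_mul_alternatizeUncurryFin_apply, Finset.sum_mul]
        congr 1
        refine Finset.sum_congr rfl fun τ _ => ?_
        have hl (i : Fin (k + 1)) : τ.viaFintypeEmbedding (Fin.castAddEmb l) (Fin.castAdd l i) =
            Fin.castAdd l (τ i) := Perm.viaFintypeEmbedding_apply_image τ (Fin.castAddEmb l) i
        have hr (i : Fin l) : τ.viaFintypeEmbedding (Fin.castAddEmb l) (Fin.natAdd (k + 1) i) =
            Fin.natAdd (k + 1) i := by
          refine Perm.viaFintypeEmbedding_apply_notMem_range _ _ ?_
          rintro ⟨j, hj⟩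
          simp [Fin.ext_iff] at hj
          omega
        simp only [hg, Perm.mul_apply, hl, hr]
        ring
  refine mul_left_cancel₀ (a := (k.factorial * l.factorial : ℝ)) (by positivity) ?_
  rw [hL, hR, hgf]

theorem alternatizeUncurryFin_wedge_right (a : E [⋀^Fin k]→L[ℝ] ℝ)
    (D : E →L[ℝ] E [⋀^Fin l]→L[ℝ] ℝ) (D' : E →L[ℝ] E [⋀^Fin (k + l)]→L[ℝ] ℝ)
    (hD' : ∀ v, D' v = wedge a (D v)) :
    alternatizeUncurryFin D' = (-1 : ℝ) ^ k • wedge a (alternatizeUncurryFin D) := by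
  ext v
  set f : Perm (Fin (k + l + 1)) → ℝ := fun σ =>
    a (fun i => v (σ (Fin.castAdd l i).succ)) *
      D (v (σ 0)) (fun i => v (σ (Fin.natAdd k i).succ)) with hf
  set g : Perm (Fin (k + (l + 1))) → ℝ := fun σ =>
    a (fun i => v (σ (Fin.castAdd (l + 1) i))) *
      D (v (σ (Fin.natAdd k 0))) (fun i => v (σ (Fin.natAdd k i.succ))) with hg
  have hgf : ∑ σ : Perm (Fin (k + l + 1)), ((Perm.sign σ : ℤ) : ℝ) * f σ = (-1 : ℝ) ^ k *
      ∑ σ : Perm (Fin (k + (l + 1))), ((Perm.sign σ : ℤ) : ℝ) * g σ := by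
    -- The sign `(-1)^k` arises from moving the differentiation slot past the `k` arguments of `a`,
    -- by a cycle of length `k + 1`.
    have h' (σ : Perm (Fin (k + (l + 1)))) :
        f (σ * (Fin.natAdd k (0 : Fin (l + 1))).cycleRange.symm) = g σ := by
      have h0 : (Fin.natAdd k (0 : Fin (l + 1))).cycleRange.symm (0 : Fin (k + l + 1)) =
          Fin.natAdd k 0 := Fin.cycleRange_symm_zero _
      have h1 (i : Fin k) : (Fin.natAdd k (0 : Fin (l + 1))).cycleRange.symm
          (Fin.castAdd l i).succ = Fin.castAdd (l + 1) i := by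
        rw [Fin.cycleRange_symm_succ, Fin.succAbove_of_castSucc_lt]
        · ext; simp
        · simp [Fin.lt_def]
      have h2 (i : Fin l) : (Fin.natAdd k (0 : Fin (l + 1))).cycleRange.symm
          (Fin.natAdd k i).succ = Fin.natAdd k i.succ := by
        rw [Fin.cycleRange_symm_succ, Fin.succAbove_of_le_castSucc]
        · ext; simp; omega
        · simp [Fin.le_def]
      simp only [hf, hg, Perm.mul_apply, h0, h1, h2]
    have h3 := sum_sign_mul_right f (Fin.natAdd k (0 : Fin (l + 1))).cycleRange.symm
    simp_rw [h', Perm.sign_symm, Fin.sign_cycleRange] at h3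
    refine Eq.trans ?_ (congrArg _ h3.symm)
    rw [← mul_assoc, Fin.val_natAdd]
    push_cast
    rw [Fin.val_zero, add_zero, ← mul_pow]
    norm_num
  have hL : (k.factorial * l.factorial : ℝ) * alternatizeUncurryFin D' v =
      ∑ σ : Perm (Fin (k + l + 1)), ((Perm.sign σ : ℤ) : ℝ) * f σ := by
    have h := sum_sign_mul_sum_viaFintypeEmbedding f (Fin.succEmb (k + l))
    rw [Fintype.card_fin] at h
    refine mul_left_cancel₀ (Nat.cast_ne_zero.2 (Nat.factorial_ne_zero (k + l))) (Eq.trans ?_ h)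
    rw [mul_left_comm, factorial_mul_alternatizeUncurryFin_apply, Finset.mul_sum]
    refine Finset.sum_congr rfl fun σ _ => ?_
    rw [hD', mul_left_comm, factorial_mul_factorial_mul_wedge_apply]
    congr 1
    refine Finset.sum_congr rfl fun τ _ => ?_
    have hs (i : Fin (k + l)) : τ.viaFintypeEmbedding (Fin.succEmb (k + l)) i.succ =
        (τ i).succ := Perm.viaFintypeEmbedding_apply_image τ (Fin.succEmb (k + l)) i
    have h0 : τ.viaFintypeEmbedding (Fin.succEmb (k + l)) 0 = 0 := by
      refine Perm.viaFintypeEmbedding_apply_notMem_range _ _ ?_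
      rintro ⟨j, hj⟩
      exact Fin.succ_ne_zero j hj
    simp only [hf, Perm.mul_apply, hs, h0]
  have hR : (k.factorial * l.factorial : ℝ) * wedge a (alternatizeUncurryFin D) v =
      ∑ σ : Perm (Fin (k + (l + 1))), ((Perm.sign σ : ℤ) : ℝ) * g σ := by
    have h := sum_sign_mul_sum_viaFintypeEmbedding g (Fin.natAddEmb (m := l + 1) k)
    rw [Fintype.card_fin] at h
    refine mul_left_cancel₀ (Nat.cast_ne_zero.2 (Nat.factorial_ne_zero (l + 1))) (Eq.trans ?_ h)
    have h' := factorial_mul_factorial_mul_wedge_apply a (alternatizeUncurryFin D) v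
    calc ((l + 1).factorial : ℝ) * ((k.factorial * l.factorial : ℝ) *
          wedge a (alternatizeUncurryFin D) v) = l.factorial * ((k.factorial * (l + 1).factorial) *
          wedge a (alternatizeUncurryFin D) v) := by ring
      _ = _ := by
        rw [h', Finset.mul_sum]
        refine Finset.sum_congr rfl fun σ _ => ?_
        rw [mul_left_comm, mul_left_comm (_ : ℝ) (a _),
          factorial_mul_alternatizeUncurryFin_apply, Finset.mul_sum]
        congr 1
        refine Finset.sum_congr rfl fun τ _ => ?_
        have hl (i : Fin (l + 1)) : τ.viaFintypeEmbedding (Fin.natAddEmb k) (Fin.natAdd k i) =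
            Fin.natAdd k (τ i) := Perm.viaFintypeEmbedding_apply_image τ (Fin.natAddEmb k) i
        have hr (i : Fin k) : τ.viaFintypeEmbedding (Fin.natAddEmb k) (Fin.castAdd (l + 1) i) =
            Fin.castAdd (l + 1) i := by
          refine Perm.viaFintypeEmbedding_apply_notMem_range _ _ ?_
          rintro ⟨j, hj⟩
          simp [Fin.ext_iff] at hj
          omega
        simp only [hg, Perm.mul_apply, hl, hr]
        ring
  refine mul_left_cancel₀ (a := (k.factorial * l.factorial : ℝ)) (by positivity) ?_
  rw [hL, hgf, ← hR]
  simp only [ContinuousAlternatingMap.smul_apply, smul_eq_mul]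
  ring

end AlternatizeUncurry

/-! ### The wedge product of forms on a normed space and the exterior derivative -/

section WedgeAnalysis

open Equiv ContinuousAlternatingMap

variable {E : Type*} [NormedAddCommGroup E] [NormedSpace ℝ E] {k l n : ℕ}

/-- A crude bound, one term per permutation; any constant would do to make the wedge a continuous
bilinear map. -/
theorem norm_wedge_le (a : E [⋀^Fin k]→L[ℝ] ℝ) (b : E [⋀^Fin l]→L[ℝ] ℝ) :
    ‖wedge a b‖ ≤ (k + l).factorial * ‖a‖ * ‖b‖ := by
  refine opNorm_le_bound _ (by positivity) fun v => ?_
  have h1 : (1 : ℝ) ≤ k.factorial * l.factorial := by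
    exact_mod_cast Nat.one_le_iff_ne_zero.2 (by positivity)
  calc ‖wedge a b v‖ ≤ (k.factorial * l.factorial) * ‖wedge a b v‖ :=
        le_mul_of_one_le_left (norm_nonneg _) h1
    _ = ‖(k.factorial * l.factorial : ℝ) * wedge a b v‖ := by
        rw [norm_mul, Real.norm_of_nonneg (zero_le_one.trans h1)]
    _ ≤ ∑ σ : Perm (Fin (k + l)), ‖a‖ * ‖b‖ * ∏ i, ‖v i‖ := by
        rw [factorial_mul_factorial_mul_wedge_apply]
        refine norm_sum_le_of_le _ fun σ _ => ?_
        have hs : ‖((Perm.sign σ : ℤ) : ℝ)‖ = 1 := by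
          rcases Int.units_eq_one_or (Equiv.Perm.sign σ) with hs | hs <;> simp [hs]
        rw [norm_mul, hs, one_mul, norm_mul, ← Equiv.prod_comp σ, Fin.prod_univ_add, mul_mul_mul_comm]
        exact mul_le_mul (a.le_opNorm _) (b.le_opNorm _) (norm_nonneg _) (by positivity)
    _ = _ := by
        rw [Finset.sum_const, Finset.card_univ, Fintype.card_perm, Fintype.card_fin, nsmul_eq_mul]
        ring

variable (E k l) in
/-- The wedge product as a continuous bilinear map. -/
noncomputable def wedgeCLM :
    (E [⋀^Fin k]→L[ℝ] ℝ) →L[ℝ] (E [⋀^Fin l]→L[ℝ] ℝ) →L[ℝ] E [⋀^Fin (k + l)]→L[ℝ] ℝ :=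
  LinearMap.mkContinuous₂
    (LinearMap.mk₂ ℝ wedge
      (fun a a' b => by
        ext v
        refine mul_left_cancel₀ (a := (k.factorial * l.factorial : ℝ)) (by positivity) ?_
        simp only [ContinuousAlternatingMap.add_apply, mul_add,
          factorial_mul_factorial_mul_wedge_apply, add_mul, Finset.sum_add_distrib])
      (fun c a b => by
        ext v
        refine mul_left_cancel₀ (a := (k.factorial * l.factorial : ℝ)) (by positivity) ?_
        rw [ContinuousAlternatingMap.smul_apply, smul_eq_mul, mul_left_comm _ c]
        simp only [factorial_mul_factorial_mul_wedge_apply, Finset.mul_sum]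
        refine Finset.sum_congr rfl fun σ _ => ?_
        simp only [ContinuousAlternatingMap.smul_apply, smul_eq_mul]
        ring)
      (fun a b b' => by
        ext v
        refine mul_left_cancel₀ (a := (k.factorial * l.factorial : ℝ)) (by positivity) ?_
        simp only [ContinuousAlternatingMap.add_apply, mul_add,
          factorial_mul_factorial_mul_wedge_apply, Finset.sum_add_distrib])
      (fun c a b => by
        ext v
        refine mul_left_cancel₀ (a := (k.factorial * l.factorial : ℝ)) (by positivity) ?_
        simp only [ContinuousAlternatingMap.smul_apply, smul_eq_mul, mul_left_comm _ c,
          factorial_mul_factorial_mul_wedge_apply, Finset.mul_sum]))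
    (k + l).factorial norm_wedge_le

@[simp]
theorem wedgeCLM_apply (a : E [⋀^Fin k]→L[ℝ] ℝ) (b : E [⋀^Fin l]→L[ℝ] ℝ) :
    wedgeCLM E k l a b = wedge a b := rfl

theorem wedge_zero_left (b : E [⋀^Fin l]→L[ℝ] ℝ) :
    wedge (0 : E [⋀^Fin k]→L[ℝ] ℝ) b = 0 := by
  simp [← wedgeCLM_apply]

theorem wedge_zero_right (a : E [⋀^Fin k]→L[ℝ] ℝ) :
    wedge a (0 : E [⋀^Fin l]→L[ℝ] ℝ) = 0 := by
  simp [← wedgeCLM_apply]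

variable {f : E → E [⋀^Fin k]→L[ℝ] ℝ} {g : E → E [⋀^Fin l]→L[ℝ] ℝ} {y : E} {s : Set E}

theorem ContDiffOn.wedge {r : WithTop ℕ∞} (hf : ContDiffOn ℝ r f s) (hg : ContDiffOn ℝ r g s) :
    ContDiffOn ℝ r (fun x => wedge (f x) (g x)) s := by
  have h : ContDiffOn ℝ r (fun x => wedgeCLM E k l (f x)) s :=
    contDiffOn_const.clm_apply hf
  exact h.clm_apply hg

theorem ContDiffOn.wedgePow {r : WithTop ℕ∞} (hf : ContDiffOn ℝ r f s) :
    ∀ n, ContDiffOn ℝ r (fun x => wedgePow (f x) n) s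
  | 0 => contDiffOn_const
  | n + 1 => (ContDiffOn.wedgePow hf n).wedge hf

theorem DifferentiableAt.wedge (hf : DifferentiableAt ℝ f y) (hg : DifferentiableAt ℝ g y) :
    DifferentiableAt ℝ (fun x => wedge (f x) (g x)) y :=
  ((wedgeCLM E k l).hasFDerivAt_of_bilinear hf.hasFDerivAt hg.hasFDerivAt).differentiableAt

theorem DifferentiableAt.wedgePow (hf : DifferentiableAt ℝ f y) :
    ∀ n, DifferentiableAt ℝ (fun x => wedgePow (f x) n) y
  | 0 => differentiableAt_const _
  | n + 1 => (DifferentiableAt.wedgePow hf n).wedge hf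

theorem minSmoothness_two_le_infty : minSmoothness ℝ 2 ≤ ∞ := by
  rw [minSmoothness_of_isRCLikeNormedField]
  norm_cast

/-- The Leibniz rule for the exterior derivative. -/
theorem extDeriv_wedge_apply (hf : DifferentiableAt ℝ f y) (hg : DifferentiableAt ℝ g y)
    (v : Fin (k + l + 1) → E) :
    extDeriv (fun x => wedge (f x) (g x)) y v =
      wedge (extDeriv f y) (g y) (v ∘ Fin.cast (Nat.add_right_comm k 1 l)) +
        (-1 : ℝ) ^ k * wedge (f y) (extDeriv g y) v := by
  have h := (wedgeCLM E k l).hasFDerivAt_of_bilinear hf.hasFDerivAt hg.hasFDerivAt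
  simp only [wedgeCLM_apply] at h
  rw [extDeriv, h.fderiv, alternatizeUncurryFin_add, ContinuousAlternatingMap.add_apply,
    add_comm (alternatizeUncurryFin _ v),
    alternatizeUncurryFin_wedge_left (fderiv ℝ f y) (g y) _ fun _ => rfl,
    alternatizeUncurryFin_wedge_right (f y) (fderiv ℝ g y) _ fun _ => rfl]
  rfl

theorem extDeriv_wedgePow_eq_zero (hf : DifferentiableAt ℝ f y) (h : extDeriv f y = 0) :
    ∀ n, extDeriv (fun x => wedgePow (f x) n) y = 0
  | 0 => by
    ext v
    simp [wedgePow, extDeriv, alternatizeUncurryFin_apply]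
  | n + 1 => by
    ext v
    change extDeriv (fun x => _root_.wedge (wedgePow (f x) n) (f x)) y v = 0
    rw [extDeriv_wedge_apply (hf.wedgePow n) hf, h, extDeriv_wedgePow_eq_zero hf h n,
      wedge_zero_left, wedge_zero_right]
    simp

/-- The other Leibniz term contains the derivative of a power of the closed form `df`, hence is
zero. -/
theorem extDeriv_wedge_wedgePow_extDeriv_apply (hf : ContDiffAt ℝ ∞ f y) (n : ℕ)
    (v : Fin (k + (k + 1) * n + 1) → E) :
    extDeriv (fun x => wedge (f x) (wedgePow (extDeriv f x) n)) y v =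
      wedge (extDeriv f y) (wedgePow (extDeriv f y) n)
        (v ∘ Fin.cast (Nat.add_right_comm k 1 ((k + 1) * n))) := by
  have hd : DifferentiableAt ℝ (extDeriv f) y := by
    have h : DifferentiableAt ℝ (fderiv ℝ f) y :=
      (hf.fderiv_right (m := 1) (by norm_cast)).differentiableAt one_ne_zero
    exact (alternatizeUncurryFinCLM ℝ E ℝ).differentiableAt.comp y h
  rw [extDeriv_wedge_apply (hf.differentiableAt (by simp)) (hd.wedgePow n),
    extDeriv_wedgePow_eq_zero hd (extDeriv_extDeriv_apply hf minSmoothness_two_le_infty),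
    wedge_zero_right]
  simp

theorem ContDiffOn.extDeriv_of_isOpen (hf : ContDiffOn ℝ ∞ f s) (hs : IsOpen s) :
    ContDiffOn ℝ ∞ (extDeriv f) s :=
  (alternatizeUncurryFinCLM ℝ E ℝ).contDiff.comp_contDiffOn
    (hf.fderiv_of_isOpen hs (by norm_cast))

/-- If `dω = ω ∧ μ`, then `dμ` vanishes on vectors `v` with `ι_v ω = 0`. -/
theorem extDeriv_apply_eq_zero_of_extDeriv_eq_wedge {q : ℕ} {α : E → E [⋀^Fin q]→L[ℝ] ℝ}
    {μ : E → E [⋀^Fin 1]→L[ℝ] ℝ} (hα : ContDiffAt ℝ ∞ α y) (hμ : DifferentiableAt ℝ μ y)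
    (hαμ : ∀ᶠ x in nhds y, extDeriv α x = wedge (α x) (μ x)) (h0 : α y ≠ 0) {K : Set E}
    (hK : ∀ (w : Fin q → E) (i : Fin q), w i ∈ K → α y w = 0) (u : Fin 2 → E)
    (hu : ∀ i, u i ∈ K) : extDeriv μ y u = 0 := by
  obtain ⟨w, hw⟩ : ∃ w, α y w ≠ 0 := by
    by_contra! h
    exact h0 (by ext w; simpa using h w)
  have h1 : extDeriv (fun x => wedge (α x) (μ x)) y = 0 := by
    rw [← Filter.EventuallyEq.extDeriv_eq hαμ]
    exact extDeriv_extDeriv_apply hα minSmoothness_two_le_infty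
  -- In the Leibniz rule `dα ∧ μ` becomes `(α ∧ μ) ∧ μ = 0`, and on `w` followed by `u` the other
  -- term is `± α(w) dμ(u)`.
  have h2 := extDeriv_wedge_apply (hα.differentiableAt (by simp)) hμ (@Fin.append q 2 E w u)
  rw [h1, hαμ.self_of_nhds, wedge_wedge_self_right_eq_zero,
    wedge_apply_of_right_mem_ker _ _ hK _ (by simpa using hu)] at h2
  simpa [hw] using h2

/-- In `dφ ∧ μ + φ dμ` both terms die on vectors of `K`; in degree two the alternatization is
expanded by hand. -/
theorem extDeriv_smul_apply_eq_zero {φ : E → ℝ} {μ : E → E [⋀^Fin 1]→L[ℝ] ℝ}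
    (hφ : DifferentiableAt ℝ φ y) (hμ : DifferentiableAt ℝ μ y) {K : Set E}
    (hφK : ∀ v ∈ K, fderiv ℝ φ y v = 0) (hμK : ∀ u : Fin 2 → E, (∀ i, u i ∈ K) →
      extDeriv μ y u = 0) (u : Fin 2 → E) (hu : ∀ i, u i ∈ K) :
    extDeriv (fun x => φ x • μ x) y u = 0 := by
  have h := hμK u hu
  rw [extDeriv, alternatizeUncurryFin_apply] at h ⊢
  rw [fderiv_fun_smul hφ hμ]
  simp only [_root_.add_apply, ContinuousAlternatingMap.add_apply,
    _root_.smul_apply, ContinuousAlternatingMap.smul_apply,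
    ContinuousLinearMap.smulRight_apply, hφK _ (hu _)] at h ⊢
  simp at h ⊢
  rw [mul_comm, mul_comm (φ y)]
  linear_combination φ y * h

theorem vanishesBelow_one {K : Set E} {a : E [⋀^Fin k]→L[ℝ] ℝ}
    (h : ∀ u : Fin k → E, (∀ i, u i ∈ K) → a u = 0) : VanishesBelow K a 1 := by
  intro w hw
  rw [Nat.lt_one_iff, Set.ncard_eq_zero] at hw
  exact h w fun i => by_contra fun hi => by simpa [hw] using (show i ∈ {i | w i ∉ K} from hi)

end WedgeAnalysis

/-! ### Naturality of the wedge product -/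

section WedgeNaturality

variable {V W : Type*} [AddCommGroup V] [Module ℝ V] [TopologicalSpace V]
  [AddCommGroup W] [Module ℝ W] [TopologicalSpace W] {k l : ℕ}

theorem wedge_compContinuousLinearMap (a : V [⋀^Fin k]→L[ℝ] ℝ) (b : V [⋀^Fin l]→L[ℝ] ℝ)
    (A : W →L[ℝ] V) : (wedge a b).compContinuousLinearMap A =
      wedge (a.compContinuousLinearMap A) (b.compContinuousLinearMap A) := by
  ext v
  rw [ContinuousAlternatingMap.compContinuousLinearMap_apply, wedge_apply, wedge_apply]
  refine Finset.sum_congr rfl fun σ _ => ?_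
  induction σ using Quotient.inductionOn' with
  | h σ =>
    exact (mul'_domCoprod_summand a b (A ∘ v) σ).trans (mul'_domCoprod_summand
      (a.compContinuousLinearMap A) (b.compContinuousLinearMap A) v σ).symm

theorem wedgePow_compContinuousLinearMap (a : V [⋀^Fin k]→L[ℝ] ℝ) (A : W →L[ℝ] V) :
    ∀ n, (wedgePow a n).compContinuousLinearMap A = wedgePow (a.compContinuousLinearMap A) n
  | 0 => by ext v; simp [wedgePow]
  | n + 1 => by
    change (wedge (wedgePow a n) a).compContinuousLinearMap A = wedge _ _
    rw [wedge_compContinuousLinearMap, wedgePow_compContinuousLinearMap a A n]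

end WedgeNaturality

/-! ### Differential forms in charts -/

section Charts

variable {m : ℕ} {M : Type*} [TopologicalSpace M] [ChartedSpace (EuclideanSpace ℝ (Fin m)) M]
  {k l : ℕ}

theorem isOpen_extChartAt_target_inter_preimage (x : M) (U : Opens M) :
    IsOpen ((extChartAt (𝓡 m) x).target ∩ (extChartAt (𝓡 m) x).symm ⁻¹' (U : Set M)) :=
  (continuousOn_extChartAt_symm x).isOpen_inter_preimage (isOpen_extChartAt_target x) U.isOpen

theorem DiffForm.IsSmoothOn.contDiffAt {α : DiffForm m M k} {U : Opens M} (h : α.IsSmoothOn U)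
    (x : M) {y : EuclideanSpace ℝ (Fin m)} (hy : y ∈ (extChartAt (𝓡 m) x).target)
    (hyU : (extChartAt (𝓡 m) x).symm y ∈ U) : ContDiffAt ℝ ∞ (α.inChart x) y :=
  (h x).contDiffAt ((isOpen_extChartAt_target_inter_preimage x U).mem_nhds ⟨hy, hyU⟩)

variable [IsManifold (𝓡 m) ∞ M]

theorem mdifferentiableAt_extChartAt_symm (x : M) {y : EuclideanSpace ℝ (Fin m)}
    (hy : y ∈ (extChartAt (𝓡 m) x).target) :
    MDifferentiableAt 𝓘(ℝ, EuclideanSpace ℝ (Fin m)) (𝓡 m) (extChartAt (𝓡 m) x).symm y :=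
  ((contMDiffOn_extChartAt_symm (n := ∞) x).contMDiffAt
    ((isOpen_extChartAt_target x).mem_nhds hy)).mdifferentiableAt (by simp)

theorem contDiffAt_extChartAt_comp_symm (x z : M) {y : EuclideanSpace ℝ (Fin m)}
    (hy : y ∈ (extChartAt (𝓡 m) x).target)
    (hz : (extChartAt (𝓡 m) x).symm y ∈ (extChartAt (𝓡 m) z).source) :
    ContDiffAt ℝ ∞ (extChartAt (𝓡 m) z ∘ (extChartAt (𝓡 m) x).symm) y := by
  rw [← contMDiffAt_iff_contDiffAt]
  refine ContMDiffAt.comp y (contMDiffAt_extChartAt' (by simpa using hz)) ?_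
  exact (contMDiffOn_extChartAt_symm x).contMDiffAt ((isOpen_extChartAt_target x).mem_nhds hy)

/-- The chain rule for the coordinate expressions of a form in two charts. -/
theorem DiffForm.inChart_eq_compContinuousLinearMap (α : DiffForm m M k) (x z : M)
    {y : EuclideanSpace ℝ (Fin m)} (hy : y ∈ (extChartAt (𝓡 m) x).target)
    (hz : (extChartAt (𝓡 m) x).symm y ∈ (extChartAt (𝓡 m) z).source) :
    α.inChart x y = (α.inChart z ((extChartAt (𝓡 m) z ∘ (extChartAt (𝓡 m) x).symm) y)
      ).compContinuousLinearMap
        (fderiv ℝ (extChartAt (𝓡 m) z ∘ (extChartAt (𝓡 m) x).symm) y) := by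
  set T := extChartAt (𝓡 m) z ∘ (extChartAt (𝓡 m) x).symm with hT
  have hTy : T y ∈ (extChartAt (𝓡 m) z).target := (extChartAt (𝓡 m) z).map_source hz
  have hsymm : (extChartAt (𝓡 m) z).symm (T y) = (extChartAt (𝓡 m) x).symm y :=
    (extChartAt (𝓡 m) z).left_inv hz
  have hev : (extChartAt (𝓡 m) x).symm =ᶠ[nhds y] (extChartAt (𝓡 m) z).symm ∘ T := by
    filter_upwards [(isOpen_extChartAt_target_inter_preimage x
      ⟨_, isOpen_extChartAt_source z⟩).mem_nhds ⟨hy, hz⟩] with y' hy'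
    exact ((extChartAt (𝓡 m) z).left_inv hy'.2).symm
  have hchain : mfderiv 𝓘(ℝ, EuclideanSpace ℝ (Fin m)) (𝓡 m) ((extChartAt (𝓡 m) z).symm ∘ T) y =
      (mfderiv 𝓘(ℝ, EuclideanSpace ℝ (Fin m)) (𝓡 m) (extChartAt (𝓡 m) z).symm (T y)).comp
        (mfderiv 𝓘(ℝ, EuclideanSpace ℝ (Fin m)) 𝓘(ℝ, EuclideanSpace ℝ (Fin m)) T y) :=
    mfderiv_comp y (mdifferentiableAt_extChartAt_symm z hTy)
      ((contDiffAt_extChartAt_comp_symm x z hy hz).differentiableAt (by simp)).mdifferentiableAt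
  rw [mfderiv_eq_fderiv] at hchain
  -- With tangent spaces identified with the model space, the types of `A` and `B` no longer depend
  -- on the base point, which can then be rewritten.
  let A : M → EuclideanSpace ℝ (Fin m) [⋀^Fin k]→L[ℝ] ℝ := α
  let B (p : EuclideanSpace ℝ (Fin m)) : EuclideanSpace ℝ (Fin m) →L[ℝ] EuclideanSpace ℝ (Fin m) :=
    mfderiv 𝓘(ℝ, EuclideanSpace ℝ (Fin m)) (𝓡 m) (extChartAt (𝓡 m) z).symm p
  have h1 : α.inChart x y = (A ((extChartAt (𝓡 m) x).symm y)).compContinuousLinearMap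
      ((B (T y)).comp (fderiv ℝ T y)) := by
    refine congrArg (A ((extChartAt (𝓡 m) x).symm y)).compContinuousLinearMap ?_
    exact (Filter.EventuallyEq.mfderiv_eq hev).trans hchain
  rw [h1, ← hsymm]
  rfl

/-- `DiffForm.d` uses a different preferred chart at each point. The result agrees with the
derivative in one fixed chart because `extDeriv` commutes with pullback along the transition map
`T`. -/
theorem DiffForm.d_inChart (α : DiffForm m M k) (x : M) {y : EuclideanSpace ℝ (Fin m)}
    (hy : y ∈ (extChartAt (𝓡 m) x).target) {U : Opens M} (hα : α.IsSmoothOn U)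
    (hyU : (extChartAt (𝓡 m) x).symm y ∈ U) :
    α.d.inChart x y = extDeriv (α.inChart x) y := by
  obtain ⟨z, hz⟩ : ∃ z, (extChartAt (𝓡 m) x).symm y = z := ⟨_, rfl⟩
  have hzs : (extChartAt (𝓡 m) x).symm y ∈ (extChartAt (𝓡 m) z).source := by
    rw [hz]; exact mem_extChartAt_source z
  set T := extChartAt (𝓡 m) z ∘ (extChartAt (𝓡 m) x).symm with hT
  have hTy : T y = extChartAt (𝓡 m) z z := by rw [hT, Function.comp_apply, hz]
  have hev : α.inChart x =ᶠ[nhds y] fun y' =>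
      (α.inChart z (T y')).compContinuousLinearMap (fderiv ℝ T y') := by
    filter_upwards [(isOpen_extChartAt_target_inter_preimage x
      ⟨_, isOpen_extChartAt_source z⟩).mem_nhds ⟨hy, hzs⟩] with y' hy'
    exact α.inChart_eq_compContinuousLinearMap x z hy'.1 hy'.2
  have hTd := contDiffAt_extChartAt_comp_symm x z hy hzs
  have hαz : DifferentiableAt ℝ (α.inChart z) (T y) := by
    refine (hα.contDiffAt z ?_ ?_).differentiableAt (by simp)
    · rw [hTy]; exact mem_extChartAt_target z
    · rw [hTy, extChartAt_to_inv, ← hz]; exact hyU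
  rw [hev.extDeriv_eq, extDeriv_pullback hαz hTd
    (minSmoothness_two_le_infty), hTy]
  have hchain : mfderiv 𝓘(ℝ, EuclideanSpace ℝ (Fin m)) 𝓘(ℝ, EuclideanSpace ℝ (Fin m)) T y =
      (mfderiv (𝓡 m) 𝓘(ℝ, EuclideanSpace ℝ (Fin m)) (extChartAt (𝓡 m) z)
        ((extChartAt (𝓡 m) x).symm y)).comp
      (mfderiv 𝓘(ℝ, EuclideanSpace ℝ (Fin m)) (𝓡 m) (extChartAt (𝓡 m) x).symm y) :=
    mfderiv_comp y ((contMDiffAt_extChartAt' (n := ∞) (by simpa using hzs)).mdifferentiableAt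
      (by simp)) (mdifferentiableAt_extChartAt_symm x hy)
  rw [mfderiv_eq_fderiv] at hchain
  rw [hchain]
  subst hz
  rfl

end Charts

/-! ### The form `η ∧ (dη)^q` -/

section GodbillonVey

variable {m : ℕ} {M : Type*} [TopologicalSpace M] [ChartedSpace (EuclideanSpace ℝ (Fin m)) M]

theorem isInvertible_mfderiv_of_mem_maximalAtlas
    {e : OpenPartialHomeomorph M (EuclideanSpace ℝ (Fin m))}
    (he : e ∈ IsManifold.maximalAtlas (𝓡 m) ∞ M) {z : M} (hz : z ∈ e.source) :
    (mfderiv (𝓡 m) 𝓘(ℝ, EuclideanSpace ℝ (Fin m)) e z).IsInvertible := by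
  have h : e.MDifferentiable (𝓡 m) (𝓡 m) :=
    ⟨(contMDiffOn_of_mem_maximalAtlas he).mdifferentiableOn (by simp),
      (contMDiffOn_symm_of_mem_maximalAtlas he).mdifferentiableOn (by simp)⟩
  exact ⟨h.mfderiv hz, rfl⟩

/-- For a one-form `η` vanishing outside `U`, the identity `dη ∧ (dη)^q = 0` extends from `U` to
`M` by continuity. -/
theorem extDeriv_wedge_wedgePow_eq_zero {U : Opens M} {q : ℕ} {η : DiffForm m M 1}
    (hη : η.IsSmoothOn ⊤) (hη0 : ∀ x ∉ U, η x = 0) (x : M)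
    (h : ∀ y ∈ (extChartAt (𝓡 m) x).target, (extChartAt (𝓡 m) x).symm y ∈ U →
      wedge (extDeriv (η.inChart x) y) (wedgePow (extDeriv (η.inChart x) y) q) = 0)
    {y : EuclideanSpace ℝ (Fin m)} (hy : y ∈ (extChartAt (𝓡 m) x).target) :
    wedge (extDeriv (η.inChart x) y) (wedgePow (extDeriv (η.inChart x) y) q) = 0 := by
  set s := (extChartAt (𝓡 m) x).target ∩ (extChartAt (𝓡 m) x).symm ⁻¹' (U : Set M) with hs
  by_cases hys : y ∈ closure s
  · have hd := (hη x).extDeriv_of_isOpen (isOpen_extChartAt_target_inter_preimage x ⊤)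
    have hc := ((hd.wedge (hd.wedgePow q)).continuousOn.continuousAt
      ((isOpen_extChartAt_target_inter_preimage x ⊤).mem_nhds ⟨hy, trivial⟩)).continuousWithinAt
      (s := s)
    have h0 := hc.mem_closure (t := {0}) hys fun p hp => h p hp.1 hp.2
    simpa using h0
  -- Off the closure of `s` there is nothing to take a limit of, but `η` vanishes on a whole
  -- neighbourhood.
  · have hev : η.inChart x =ᶠ[nhds y] fun _ => 0 := by
      filter_upwards [isClosed_closure.isOpen_compl.mem_nhds hys,
        (isOpen_extChartAt_target x).mem_nhds hy] with p hp hpt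
      have hpU : (extChartAt (𝓡 m) x).symm p ∉ U := fun hpU => hp (subset_closure ⟨hpt, hpU⟩)
      simp only [DiffForm.inChart, hη0 _ hpU]
      rfl
    have h0 : extDeriv (η.inChart x) y = 0 := by
      rw [hev.extDeriv_eq]
      ext v
      simp [extDeriv, ContinuousAlternatingMap.alternatizeUncurryFin_apply]
    rw [h0, wedge_zero_left]

variable [IsManifold (𝓡 m) ∞ M]

theorem isInvertible_mfderiv_extChartAt_symm_of_mem_target (x : M) {y : EuclideanSpace ℝ (Fin m)}
    (hy : y ∈ (extChartAt (𝓡 m) x).target) :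
    (mfderiv 𝓘(ℝ, EuclideanSpace ℝ (Fin m)) (𝓡 m) (extChartAt (𝓡 m) x).symm y).IsInvertible := by
  have : IsManifold (𝓡 m) 1 M := IsManifold.of_le (n := ∞) (by norm_cast)
  have h := isInvertible_mfderivWithin_extChartAt_symm (I := 𝓡 m) hy
  rwa [ModelWithCorners.range_eq_univ, mfderivWithin_univ] at h

/-- The tangent space of the leaf through a point, read in the chart at `x`. -/
def RegularFoliation.tangentInChart {U : Opens M} {r : ℕ} (F : RegularFoliation m U r) (x : M)
    (y : EuclideanSpace ℝ (Fin m)) : Set (EuclideanSpace ℝ (Fin m)) :=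
  {v | mfderiv 𝓘(ℝ, EuclideanSpace ℝ (Fin m)) (𝓡 m) (extChartAt (𝓡 m) x).symm y v ∈
    F.tangent ((extChartAt (𝓡 m) x).symm y)}

/-- The basis is the coordinate frame of a foliated chart, carried to the chart at `x` by the
inverse of the derivative `C` of the change of charts. Its first `r` vectors are tangent to the
leaves. -/
theorem RegularFoliation.exists_basis_ncard_le {U : Opens M} {r q : ℕ} (hrq : r + q = m)
    (F : RegularFoliation m U r) (x : M) {y : EuclideanSpace ℝ (Fin m)}
    (hy : y ∈ (extChartAt (𝓡 m) x).target) (hyU : (extChartAt (𝓡 m) x).symm y ∈ U) :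
    ∃ b : Module.Basis (Fin m) ℝ (EuclideanSpace ℝ (Fin m)),
      {i | b i ∉ F.tangentInChart x y}.ncard ≤ q := by
  obtain ⟨e, he, hes, hF⟩ := F.exists_foliated_chart _ hyU
  obtain ⟨A, hA⟩ := isInvertible_mfderiv_extChartAt_symm_of_mem_target x hy
  obtain ⟨B, hB⟩ := isInvertible_mfderiv_of_mem_maximalAtlas he hes
  let C : EuclideanSpace ℝ (Fin m) ≃L[ℝ] EuclideanSpace ℝ (Fin m) := A.trans B
  refine ⟨(EuclideanSpace.basisFun (Fin m) ℝ).toBasis.map C.symm.toLinearEquiv, ?_⟩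
  have hC (v : EuclideanSpace ℝ (Fin m)) (hv : ∀ i : Fin m, r ≤ (i : ℕ) → C v i = 0) :
      v ∈ F.tangentInChart x y := by
    refine ((hF _ hes).2 _).2 fun i hi => ?_
    rw [← hA, ← hB]
    exact hv i hi
  calc _ ≤ {i : Fin m | r ≤ (i : ℕ)}.ncard := by
        refine Set.ncard_le_ncard (fun i hi => ?_) (Set.toFinite _)
        by_contra hir
        refine hi (hC _ fun j hj => ?_)
        have hne : j ≠ i := fun h => hir (by simpa [h] using hj)
        simp [hne]
    _ ≤ (Finset.Ico r m).card := by
        rw [← Set.ncard_coe_finset, ← Set.ncard_image_of_injective _ Fin.val_injective]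
        refine Set.ncard_le_ncard ?_ (Set.toFinite _)
        rintro _ ⟨i, hi, rfl⟩
        simpa using hi
    _ = q := by simp; omega

/-- The form `η ∧ (dη)^q` in a chart. -/
theorem DiffForm.godbillonVey_inChart {η : DiffForm m M 1} (hη : η.IsSmoothOn ⊤) (q : ℕ) (x : M)
    {y : EuclideanSpace ℝ (Fin m)} (hy : y ∈ (extChartAt (𝓡 m) x).target) :
    (η.godbillonVey q).inChart x y =
      wedge (η.inChart x y) (wedgePow (extDeriv (η.inChart x) y) q) := by
  rw [← η.d_inChart x hy hη trivial]
  exact (wedge_compContinuousLinearMap _ _ _).trans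
    (congrArg (wedge _) (wedgePow_compContinuousLinearMap _ _ q))

theorem DiffForm.IsSmoothOn.godbillonVey {η : DiffForm m M 1} (hη : η.IsSmoothOn ⊤) (q : ℕ) :
    (η.godbillonVey q).IsSmoothOn ⊤ := by
  intro x
  have hη' := hη x
  have hs := isOpen_extChartAt_target_inter_preimage (m := m) x (⊤ : Opens M)
  refine (hη'.wedge ((hη'.extDeriv_of_isOpen hs).wedgePow q)).congr fun y hy => ?_
  exact η.godbillonVey_inChart hη q x hy.1

/-- The form `η ∧ (dη)^q` is closed if `dη ∧ (dη)^q` vanishes in all charts. -/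
theorem DiffForm.d_godbillonVey_eq_zero {η : DiffForm m M 1} (hη : η.IsSmoothOn ⊤) (q : ℕ)
    (h : ∀ x : M, ∀ y ∈ (extChartAt (𝓡 m) x).target,
      wedge (extDeriv (η.inChart x) y) (wedgePow (extDeriv (η.inChart x) y) q) = 0) :
    (η.godbillonVey q).d = 0 := by
  funext x
  have hx := mem_extChartAt_target (I := 𝓡 m) x
  have h1 : extDeriv ((η.godbillonVey q).inChart x) (extChartAt (𝓡 m) x x) = 0 := by
    have hev : (η.godbillonVey q).inChart x =ᶠ[nhds (extChartAt (𝓡 m) x x)] fun y =>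
        wedge (η.inChart x y) (wedgePow (extDeriv (η.inChart x) y) q) := by
      filter_upwards [(isOpen_extChartAt_target x).mem_nhds hx] with y hy
      exact η.godbillonVey_inChart hη q x hy
    rw [hev.extDeriv_eq]
    ext v
    rw [extDeriv_wedge_wedgePow_extDeriv_apply (hη.contDiffAt x hx trivial), h x _ hx]
    simp
  rw [DiffForm.d, h1]
  rfl

/-- If `dα = α ∧ μ` for the form `α` defining the foliation and `φ` is basic, then `η = φ μ`
satisfies `dη ∧ (dη)^q = 0`: the form `dη` vanishes on pairs of vectors tangent to the leaves. -/
theorem extDeriv_wedge_wedgePow_eq_zero_of_mem {U : Opens M} {r q : ℕ} (hrq : r + q = m)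
    (F : RegularFoliation m U r) {α : DiffForm m M q} (hα : F.IsDefinedBy α)
    {μ : DiffForm m M 1} (hμ : μ.IsSmoothOn U) (hαμ : ∀ x ∈ U, α.d x = wedge (α x) (μ x))
    {φ : M → ℝ} (hφ : ContMDiff (𝓡 m) 𝓘(ℝ, ℝ) ∞ φ) (hφF : F.IsBasic φ)
    {η : DiffForm m M 1} (hη : ∀ x ∈ U, η x = φ x • μ x) (x : M)
    {y : EuclideanSpace ℝ (Fin m)} (hy : y ∈ (extChartAt (𝓡 m) x).target)
    (hyU : (extChartAt (𝓡 m) x).symm y ∈ U) :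
    wedge (extDeriv (η.inChart x) y) (wedgePow (extDeriv (η.inChart x) y) q) = 0 := by
  have hnhds := (isOpen_extChartAt_target_inter_preimage x U).mem_nhds ⟨hy, hyU⟩
  have hμy := (hμ.contDiffAt x hy hyU).differentiableAt (by simp)
  have hαK (w : Fin q → EuclideanSpace ℝ (Fin m)) (i : Fin q) (hi : w i ∈ F.tangentInChart x y) :
      α.inChart x y w = 0 :=
    (hα.mem_tangent_iff _ hyU _).1 hi _ i rfl
  -- The derivative of the inverse chart is onto, so a zero coordinate expression would force `α`
  -- itself to vanish at the point.
  have hα0 : α.inChart x y ≠ 0 := by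
    obtain ⟨A, hA⟩ := isInvertible_mfderiv_extChartAt_symm_of_mem_target x hy
    intro h0
    refine hα.ne_zero _ hyU ?_
    ext w
    have h1 : α ((extChartAt (𝓡 m) x).symm y)
        (fun i => mfderiv 𝓘(ℝ, EuclideanSpace ℝ (Fin m)) (𝓡 m) (extChartAt (𝓡 m) x).symm y
          (A.symm (w i))) = 0 :=
      congrArg (fun a : EuclideanSpace ℝ (Fin m) [⋀^Fin q]→L[ℝ] ℝ => a (A.symm ∘ w)) h0
    have h2 (i : Fin q) : mfderiv 𝓘(ℝ, EuclideanSpace ℝ (Fin m)) (𝓡 m) (extChartAt (𝓡 m) x).symm y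
        (A.symm (w i)) = w i := by
      rw [← hA]
      exact A.apply_symm_apply (w i)
    rw [funext h2] at h1
    exact h1
  have hd : ∀ᶠ p in nhds y, extDeriv (α.inChart x) p = wedge (α.inChart x p) (μ.inChart x p) := by
    filter_upwards [hnhds] with p hp
    rw [← α.d_inChart x hp.1 hα.isSmoothOn hp.2]
    exact (congrArg (fun a => ContinuousAlternatingMap.compContinuousLinearMap a
      (mfderiv 𝓘(ℝ, EuclideanSpace ℝ (Fin m)) (𝓡 m) (extChartAt (𝓡 m) x).symm p))
      (hαμ _ hp.2)).trans (wedge_compContinuousLinearMap _ _ _)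
  have hφs := (hφ.mdifferentiable (by simp)) ((extChartAt (𝓡 m) x).symm y)
  have hφx : MDifferentiableAt 𝓘(ℝ, EuclideanSpace ℝ (Fin m)) 𝓘(ℝ, ℝ)
      (φ ∘ (extChartAt (𝓡 m) x).symm) y :=
    hφs.comp y (mdifferentiableAt_extChartAt_symm x hy)
  have hφK : ∀ v ∈ F.tangentInChart x y, fderiv ℝ (φ ∘ (extChartAt (𝓡 m) x).symm) y v = 0 := by
    intro v hv
    have h1 := hφF _ hyU _ hv
    rw [← mfderiv_eq_fderiv, mfderiv_comp y hφs (mdifferentiableAt_extChartAt_symm x hy)]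
    exact h1
  have hη' : η.inChart x =ᶠ[nhds y] fun p =>
      (φ ∘ (extChartAt (𝓡 m) x).symm) p • μ.inChart x p := by
    filter_upwards [hnhds] with p hp
    simp only [DiffForm.inChart, hη _ hp.2]
    rfl
  have hv : VanishesBelow (F.tangentInChart x y) (extDeriv (η.inChart x) y) 1 := by
    rw [hη'.extDeriv_eq]
    exact vanishesBelow_one (extDeriv_smul_apply_eq_zero hφx.differentiableAt hμy hφK
      (extDeriv_apply_eq_zero_of_extDeriv_eq_wedge (hα.isSmoothOn.contDiffAt x hy hyU) hμy hd hα0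
        hαK))
  obtain ⟨b, hb⟩ := F.exists_basis_ncard_le hrq x hy hyU
  -- The product needs `1 + q` transverse entries, one more than the basis can supply.
  exact (hv.wedge (hv.wedgePow q)).eq_zero b (by omega)

end GodbillonVey

theorem proposition4p5 {m : ℕ} {M : Type*} [TopologicalSpace M]
    [ChartedSpace (EuclideanSpace ℝ (Fin m)) M] [IsManifold (𝓡 m) ∞ M]
    (U : Opens M) (r q : ℕ) (hrq : r + q = m)
    (F : RegularFoliation m U r)
    (ωF : DiffForm m M q) (hωF : F.IsDefinedBy ωF)
    (μ : DiffForm m M 1) (hμ : μ.IsSmoothOn U) (hωFμ : ∀ x ∈ U, ωF.d x = wedge (ωF x) (μ x))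
    (φ : M → ℝ) (hφ : IsTestFunction m φ (U : Set M)ᶜ) (hφF : F.IsBasic φ)
    (μbar : DiffForm m M 1) (hμbar_eq : ∀ x ∈ U, μbar x = φ x • μ x)
    (hμbar_zero : ∀ x ∉ U, μbar x = 0)
    (hμbar : μbar.IsSmoothOn ⊤) :
    (μbar.godbillonVey q).IsSmoothOn ⊤ ∧ (μbar.godbillonVey q).d = 0 ∧
      ∃! c : DeRhamCohomology m M (1 + 2 * q), c.IsClassOf (μbar.godbillonVey q) := by
  have hsmooth := hμbar.godbillonVey q
  have hd : (μbar.godbillonVey q).d = 0 :=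
    μbar.d_godbillonVey_eq_zero hμbar q fun x y hy =>
      extDeriv_wedge_wedgePow_eq_zero hμbar hμbar_zero x (fun _ hp hpU =>
        extDeriv_wedge_wedgePow_eq_zero_of_mem hrq F hωF hμ hωFμ hφ.contMDiff hφF hμbar_eq x hp hpU)
        hy
  exact ⟨hsmooth, hd, Submodule.Quotient.mk ⟨_, hsmooth, hd⟩, ⟨⟨hsmooth, hd⟩, rfl⟩,
    fun _ ⟨_, h⟩ => h.symm⟩
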